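/- Let $X$ be a Banach space over the scalar field $\mathbb K=\mathbb R$ or $\mathbb C$, let $\kappa_X\colon X\to X^{**}$ be the canonical embedding into the second dual, and let $\lambda\ge 1$. For a semigroup $S$, let $\ell_\infty(S,X)$ be the Banach space of all bounded functions $f\colon S\to X$ with the supremum norm. An \emph{$X$-valued invariant $\lambda$-mean} on $S$ is a bounded linear operator $M\colon \ell_\infty(S,X)\to X$ with $\|M\|\le\lambda$ such that $M(x\mathbf 1_S)=x$ for every $x\in X$, where $x\mathbf 1_S$ is the function constantly equal to $x$, and $M({}_sf)=M(f_s)=M(f)$ for all $s\in S$ and $f\in\ell_\infty(S,X)$, where ${}_sf(t)=f(st)$ and $f_s(t)=f(ts)$. A semigroup is \emph{amenable} if it carries a $\mathbb K$-valued invariant $1$-mean. Theorem A. The following assertions are equivalent. (i) $X$ is complemented in $X^{**}$ by a projection of norm at most $\lambda$, that is, there is a bounded linear operator $P\colon X^{**}\to X^{**}$ with $P^2=P$, $P(X^{**})=\kappa_X(X)$ and $\|P\|\le\lambda$. (ii) For every amenable semigroup $S$ there exists an $X$-valued invariant $\lambda$-mean on $S$. (iii) When $G$ is a free Abelian group whose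 rank is the cardinality $|X^{**}|$ of the set $X^{**}$, there exists an $X$-valued invariant $\lambda$-mean on $G$. (iv) There exists an $X$-valued invariant $\lambda$-mean on the additive group of $X^{**}$. -/

import Mathlib

set_option maxSynthPendingDepth 3

open scoped ENNReal

universe u v w

noncomputable section

namespace VectorMean

/-- `ℓ_∞(S, X)`: the Banach space of all bounded `X`-valued functions on the set `S`,
with the supremum norm. -/
abbrev Linfty (S : Type*) (X : Type*) [NormedAddCommGroup X] : Type _ :=
  lp (fun _ : S => X) ∞

section

variable {S : Type*} {X : Type*} [NormedAddCommGroup X]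

/-- The function on `S` constantly equal to `x`. -/
def const (S : Type*) (x : X) : Linfty S X :=
  ⟨fun _ => x, memℓp_infty ⟨‖x‖, by rintro _ ⟨_, rfl⟩; exact le_rfl⟩⟩

/-- The bounded function `f ∘ φ`. -/
def comp {T : Type*} (f : Linfty T X) (φ : S → T) : Linfty S X :=
  ⟨fun t => f (φ t), memℓp_infty ⟨‖f‖, by
    rintro _ ⟨t, rfl⟩; exact lp.norm_apply_le_norm ENNReal.top_ne_zero f (φ t)⟩⟩

/-- The translate `t ↦ f (s * t)`. -/
def leftTranslate [Mul S] (s : S) (f : Linfty S X) : Linfty S X :=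
  comp f fun t => s * t

/-- The translate `t ↦ f (t * s)`. -/
def rightTranslate [Mul S] (s : S) (f : Linfty S X) : Linfty S X :=
  comp f fun t => t * s

end

/-- `M : ℓ_∞(S, X) → X` is an `X`-valued invariant `c`-mean on the semigroup `S`. -/
structure IsInvariantMean {𝕜 : Type*} [RCLike 𝕜] {S : Type*} [Semigroup S]
    {X : Type*} [NormedAddCommGroup X] [NormedSpace 𝕜 X]
    (c : ℝ) (M : Linfty S X →L[𝕜] X) : Prop where
  norm_le : ‖M‖ ≤ c
  map_const : ∀ x : X, M (const S x) = x
  map_left : ∀ (s : S) (f : Linfty S X), M (leftTranslate s f) = M f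
  map_right : ∀ (s : S) (f : Linfty S X), M (rightTranslate s f) = M f

/-- There is an `X`-valued invariant `c`-mean on the semigroup `S`. -/
def HasInvariantMean (𝕜 : Type*) [RCLike 𝕜] (S : Type*) [Semigroup S]
    (X : Type*) [NormedAddCommGroup X] [NormedSpace 𝕜 X] (c : ℝ) : Prop :=
  ∃ M : Linfty S X →L[𝕜] X, IsInvariantMean c M

/-- A semigroup is amenable if it carries a scalar-valued invariant `1`-mean. -/
def IsAmenable (𝕜 : Type*) [RCLike 𝕜] (S : Type*) [Semigroup S] : Prop :=
  HasInvariantMean 𝕜 S 𝕜 1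

/-- The second dual `X**`. -/
abbrev Bidual (𝕜 : Type*) [RCLike 𝕜] (X : Type*) [NormedAddCommGroup X] [NormedSpace 𝕜 X] :
    Type _ :=
  StrongDual 𝕜 (StrongDual 𝕜 X)

/-- There is a bounded linear projection of `X**`, of norm at most `c`, onto the canonical
image of `X` in `X**`. -/
def IsComplementedInBidual (𝕜 : Type*) [RCLike 𝕜] (X : Type*) [NormedAddCommGroup X]
    [NormedSpace 𝕜 X] (c : ℝ) : Prop :=
  ∃ P : Bidual 𝕜 X →L[𝕜] Bidual 𝕜 X,
    (∀ ξ, P (P ξ) = P ξ) ∧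
    Set.range P = Set.range (NormedSpace.inclusionInDoubleDual 𝕜 X) ∧
    ‖P‖ ≤ c

end VectorMean

end

/-! A projection `P` turns a scalar mean `m` into `f ↦ P (x' ↦ m (x' ∘ f))`, read back in `X`.
Commutative groups are amenable (`isAmenable_of_comm`), and `X**` is a quotient of the free Abelian
group on its points, so the content is recovering a projection from a mean `M` on `X**`.

Any finite set of linear relations in `X**` with right-hand sides in `X` can be solved approximately
in `X` without increasing norms (`exists_approx_relations`); `M` takes the limit of these solutions.
There are at most `|X**|` pairs (relation, tolerance) by `mk_relation_le`, so each gets its own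
vector of a `ℚ`-basis of `X**`. A point `g` has finite support, hence selects finitely many pairs
and a common approximate solution. A given pair is ignored only where its coordinate vanishes, a
subgroup that is null for `M` (`IsInvariantMean.eq_zero_of_support`). Averaging over `g` therefore
makes all relations exact, which gives a linear map `X** → X` that is the identity on `X`. -/

namespace VectorMean

noncomputable section

/-! ### Bounded functions and `X**`-valued means -/

section Linfty

variable {𝕜 : Type*} [RCLike 𝕜] {S T : Type*} {X : Type*} [NormedAddCommGroup X]
  [NormedSpace 𝕜 X]

@[simp]
lemma const_apply (x : X) (s : S) : const S x s = x := rfl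

lemma norm_apply_le (f : Linfty S X) (s : S) : ‖f s‖ ≤ ‖f‖ :=
  lp.norm_apply_le_norm ENNReal.top_ne_zero f s

lemma norm_comp_le (f : Linfty T X) (φ : S → T) : ‖comp f φ‖ ≤ ‖f‖ :=
  lp.norm_le_of_forall_le (norm_nonneg f) fun s => norm_apply_le f (φ s)

/-- The bounded function with the given values and bound. -/
def ofBound (f : S → X) (C : ℝ) (h : ∀ s, ‖f s‖ ≤ C) : Linfty S X :=
  ⟨f, memℓp_infty ⟨C, by rintro _ ⟨s, rfl⟩; exact h s⟩⟩

@[simp]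
lemma ofBound_apply (f : S → X) (C : ℝ) (h : ∀ s, ‖f s‖ ≤ C) (s : S) :
    ofBound f C h s = f s := rfl

variable (𝕜) in
/-- Composition with a map of the index sets, as a bounded operator. -/
def compL (X : Type*) [NormedAddCommGroup X] [NormedSpace 𝕜 X] (φ : S → T) :
    Linfty T X →L[𝕜] Linfty S X :=
  LinearMap.mkContinuous
    { toFun := fun f => comp f φ
      map_add' := fun _ _ => rfl
      map_smul' := fun _ _ => rfl } 1 fun f => by
        rw [one_mul]
        exact norm_comp_le f φ

lemma norm_compL_le (φ : S → T) : ‖compL 𝕜 X φ‖ ≤ 1 :=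
  LinearMap.mkContinuous_norm_le _ zero_le_one _

/-- The scalar function `s ↦ x' (f s)`. -/
def evalDual (x' : StrongDual 𝕜 X) (f : Linfty S X) : Linfty S 𝕜 :=
  ofBound (fun s => x' (f s)) (‖x'‖ * ‖f‖) fun s =>
    (x'.le_opNorm _).trans (mul_le_mul_of_nonneg_left (norm_apply_le f s) (norm_nonneg x'))

lemma norm_evalDual_le (x' : StrongDual 𝕜 X) (f : Linfty S X) :
    ‖evalDual x' f‖ ≤ ‖x'‖ * ‖f‖ :=
  lp.norm_le_of_forall_le (by positivity) fun s =>
    (x'.le_opNorm _).trans (mul_le_mul_of_nonneg_left (norm_apply_le f s) (norm_nonneg x'))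

/-- A scalar mean `m` extends to the map `ℓ_∞(S, X) → X**`, `f ↦ (x' ↦ m (x' ∘ f))`. -/
def bidualMean (m : Linfty S 𝕜 →L[𝕜] 𝕜) : Linfty S X →L[𝕜] Bidual 𝕜 X :=
  LinearMap.mkContinuous₂
    { toFun := fun f =>
        { toFun := fun x' => m (evalDual x' f)
          map_add' := fun x' y' => by rw [← map_add]; rfl
          map_smul' := fun a x' => by rw [RingHom.id_apply, ← map_smul]; rfl }
      map_add' := fun f g => by
        ext x'
        change m _ = m _ + m _
        rw [← map_add]
        congr 1
        ext s
        exact map_add x' (f s) (g s)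
      map_smul' := fun a f => by
        ext x'
        change m _ = a • m _
        rw [← map_smul]
        congr 1
        ext s
        exact map_smul x' a (f s) }
    ‖m‖ fun f x' => by
      refine (m.le_opNorm _).trans ?_
      rw [mul_assoc, mul_comm ‖f‖]
      exact mul_le_mul_of_nonneg_left (norm_evalDual_le x' f) (norm_nonneg m)

lemma norm_bidualMean_le (m : Linfty S 𝕜 →L[𝕜] 𝕜) :
    ‖(bidualMean m : Linfty S X →L[𝕜] Bidual 𝕜 X)‖ ≤ ‖m‖ :=
  LinearMap.mkContinuous₂_norm_le _ (norm_nonneg m) _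

end Linfty

/-- If `X` is `c`-complemented in `X**`, every amenable semigroup has an `X`-valued
invariant `c`-mean. -/
theorem IsComplementedInBidual.hasInvariantMean {𝕜 : Type*} [RCLike 𝕜] {X : Type*}
    [NormedAddCommGroup X] [NormedSpace 𝕜 X] {c : ℝ} (h : IsComplementedInBidual 𝕜 X c)
    {S : Type*} [Semigroup S] (hS : IsAmenable 𝕜 S) : HasInvariantMean 𝕜 S X c := by
  obtain ⟨P, hPP, hPr, hPc⟩ := h
  obtain ⟨m, hm⟩ := hS
  have hκ : ∀ x : X, ‖NormedSpace.inclusionInDoubleDual 𝕜 X x‖ = ‖x‖ :=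
    (NormedSpace.inclusionInDoubleDualLi (E := X) 𝕜).norm_map
  have hκi : Function.Injective (NormedSpace.inclusionInDoubleDual 𝕜 X) :=
    (NormedSpace.inclusionInDoubleDualLi (E := X) 𝕜).injective
  have hP : ∀ x : X, P (NormedSpace.inclusionInDoubleDual 𝕜 X x) =
      NormedSpace.inclusionInDoubleDual 𝕜 X x := fun x => by
    obtain ⟨ξ, hξ⟩ : NormedSpace.inclusionInDoubleDual 𝕜 X x ∈ Set.range P :=
      hPr ▸ Set.mem_range_self x
    rw [← hξ, hPP]
  have hex : ∀ f : Linfty S X, ∃ x : X,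
      NormedSpace.inclusionInDoubleDual 𝕜 X x = P (bidualMean m f) := fun f => by
    have : P (bidualMean m f) ∈ Set.range P := Set.mem_range_self _
    rwa [hPr] at this
  choose M hM using hex
  have hc : 0 ≤ c := (norm_nonneg P).trans hPc
  let ML : Linfty S X →L[𝕜] X := LinearMap.mkContinuous
    { toFun := M
      map_add' := fun f g => hκi (by simp [hM])
      map_smul' := fun a f => hκi (by simp [hM]) } c fun f => by
        change ‖M f‖ ≤ c * ‖f‖
        rw [← hκ, hM]
        refine (P.le_opNorm _).trans (mul_le_mul hPc ?_ (norm_nonneg _) hc)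
        refine ((bidualMean m).le_opNorm f).trans ?_
        exact mul_le_of_le_one_left (norm_nonneg f) ((norm_bidualMean_le m).trans hm.norm_le)
  refine ⟨ML, LinearMap.mkContinuous_norm_le _ hc _, fun x => ?_, fun s f => ?_, fun s f => ?_⟩
  · apply hκi
    change NormedSpace.inclusionInDoubleDual 𝕜 X (M _) = _
    rw [hM, ← hP x]
    congr 1
    ext x'
    exact hm.map_const (x' x)
  · apply hκi
    change NormedSpace.inclusionInDoubleDual 𝕜 X (M _) =
      NormedSpace.inclusionInDoubleDual 𝕜 X (M _)
    rw [hM, hM]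
    congr 1
    ext x'
    exact hm.map_left s (evalDual x' f)
  · apply hκi
    change NormedSpace.inclusionInDoubleDual 𝕜 X (M _) =
      NormedSpace.inclusionInDoubleDual 𝕜 X (M _)
    rw [hM, hM]
    congr 1
    ext x'
    exact hm.map_right s (evalDual x' f)

/-- Invariant means push forward along surjective homomorphisms. -/
theorem HasInvariantMean.of_surjective {𝕜 : Type*} [RCLike 𝕜] {X : Type*}
    [NormedAddCommGroup X] [NormedSpace 𝕜 X] {c : ℝ} {S T : Type*} [Semigroup S] [Semigroup T]
    (h : HasInvariantMean 𝕜 S X c) (φ : S →ₙ* T) (hφ : Function.Surjective φ) :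
    HasInvariantMean 𝕜 T X c := by
  obtain ⟨M, hM⟩ := h
  refine ⟨M.comp (compL 𝕜 X φ), ?_, fun x => hM.map_const x, fun t f => ?_, fun t f => ?_⟩
  · refine (M.opNorm_comp_le _).trans ?_
    exact (mul_le_of_le_one_right (norm_nonneg M) (norm_compL_le _)).trans hM.norm_le
  · obtain ⟨s, rfl⟩ := hφ t
    change M (comp (leftTranslate (φ s) f) φ) = M (comp f φ)
    refine Eq.trans (congrArg M ?_) (hM.map_left s (comp f φ))
    ext r
    exact congrArg f (map_mul φ s r).symm
  · obtain ⟨s, rfl⟩ := hφ t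
    change M (comp (rightTranslate (φ s) f) φ) = M (comp f φ)
    refine Eq.trans (congrArg M ?_) (hM.map_right s (comp f φ))
    ext r
    exact congrArg f (map_mul φ r s).symm

/-! ### Amenability of commutative semigroups -/

section Amenable

variable {𝕜 : Type*} [RCLike 𝕜] {E : Type*} [NormedAddCommGroup E] [NormedSpace 𝕜 E]

/-- The Cesàro mean of the first `n + 1` powers of `T`. -/
def cesaro (T : E →L[𝕜] E) (n : ℕ) : E →L[𝕜] E :=
  ((n : 𝕜) + 1)⁻¹ • ∑ j ∈ Finset.range (n + 1), T ^ j

lemma norm_pow_apply_le {T : E →L[𝕜] E} (hT : ‖T‖ ≤ 1) (n : ℕ) (x : E) :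
    ‖(T ^ n) x‖ ≤ ‖x‖ := by
  induction n with
  | zero => simp
  | succ n ih =>
    rw [pow_succ', mul_apply_eq_comp]
    exact (T.le_of_opNorm_le hT _).trans (by simpa using ih)

lemma norm_natCast_add_one_inv (n : ℕ) : ‖((n : 𝕜) + 1)⁻¹‖ = ((n : ℝ) + 1)⁻¹ := by
  rw [norm_inv, ← Nat.cast_succ, RCLike.norm_natCast, Nat.cast_succ]

lemma norm_cesaro_apply_le {T : E →L[𝕜] E} (hT : ‖T‖ ≤ 1) (n : ℕ) (x : E) :
    ‖cesaro T n x‖ ≤ ‖x‖ := by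
  have h : ‖(∑ j ∈ Finset.range (n + 1), T ^ j) x‖ ≤ ((n : ℝ) + 1) * ‖x‖ := by
    rw [sum_apply]
    refine (norm_sum_le_of_le _ fun j _ => norm_pow_apply_le hT j x).trans ?_
    simp
  rw [cesaro, smul_apply, norm_smul, norm_natCast_add_one_inv]
  rwa [inv_mul_le_iff₀ (by positivity)]

lemma cesaro_apply_of_fixed {T : E →L[𝕜] E} {x : E} (hx : T x = x) (n : ℕ) :
    cesaro T n x = x := by
  have h : ∀ j, (T ^ j) x = x := fun j => by
    induction j with
    | zero => simp
    | succ j ih => rw [pow_succ', mul_apply_eq_comp, ih, hx]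
  have hn : (n : 𝕜) + 1 ≠ 0 := Nat.cast_add_one_ne_zero n
  simp only [cesaro, smul_apply, sum_apply, h,
    Finset.sum_const, Finset.card_range]
  rw [← Nat.cast_smul_eq_nsmul 𝕜, Nat.cast_succ, smul_smul, inv_mul_cancel₀ hn, one_smul]

lemma cesaro_apply_sub (T : E →L[𝕜] E) (n : ℕ) (x : E) :
    cesaro T n (T x - x) = ((n : 𝕜) + 1)⁻¹ • ((T ^ (n + 1)) x - x) := by
  have h := congrArg (fun A : E →L[𝕜] E => A x) (geom_sum_mul T (n + 1))
  simp only [mul_apply_eq_comp, sub_apply,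
    one_apply_eq_self] at h
  rw [cesaro, smul_apply, h]

lemma norm_cesaro_apply_sub_le {T : E →L[𝕜] E} (hT : ‖T‖ ≤ 1) (n : ℕ) (x : E) :
    ‖cesaro T n (T x - x)‖ ≤ 2 * ‖x‖ / (n + 1) := by
  rw [cesaro_apply_sub, norm_smul, norm_natCast_add_one_inv, inv_mul_eq_div]
  gcongr
  refine (norm_sub_le _ _).trans ?_
  linarith [norm_pow_apply_le hT (n + 1) x]

lemma commute_cesaro {T U : E →L[𝕜] E} (h : Commute T U) (m n : ℕ) :
    Commute (cesaro T m) (cesaro U n) :=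
  ((Commute.sum_left _ _ _ fun _ _ => Commute.sum_right _ _ _ fun _ _ =>
    h.pow_pow _ _).smul_left _).smul_right _

/-- A commuting family of contractions with a common fixed unit vector `v` has a common fixed
norm-one functional taking the value `1` at `v`. -/
theorem exists_invariant_functional {ι : Type*} (T : ι → E →L[𝕜] E)
    (hcomm : ∀ i j, Commute (T i) (T j)) (hT : ∀ i, ‖T i‖ ≤ 1) {v : E} (hv : ‖v‖ = 1)
    (hTv : ∀ i, T i v = v) :
    ∃ m : E →L[𝕜] 𝕜, ‖m‖ ≤ 1 ∧ m v = 1 ∧ ∀ i x, m (T i x) = m x := by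
  let C : Set (E →L[𝕜] E) := Set.range fun p : ι × ℕ => cesaro (T p.1) p.2
  have hCc : ∀ A ∈ Submonoid.closure C, ∀ B ∈ Submonoid.closure C, A * B = B * A := by
    have := Submonoid.isMulCommutative_closure (E →L[𝕜] E) (s := C) (by
      rintro _ ⟨p, rfl⟩ _ ⟨q, rfl⟩
      exact commute_cesaro (hcomm p.1 q.1) p.2 q.2)
    intro A hA B hB
    exact congrArg Subtype.val (mul_comm' (⟨A, hA⟩ : Submonoid.closure C) ⟨B, hB⟩)
  have hC : ∀ A ∈ Submonoid.closure C, (∀ x, ‖A x‖ ≤ ‖x‖) ∧ A v = v := by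
    intro A hA
    induction hA using Submonoid.closure_induction with
    | mem A hA =>
      obtain ⟨p, rfl⟩ := hA
      exact ⟨norm_cesaro_apply_le (hT p.1) p.2, cesaro_apply_of_fixed (hTv p.1) p.2⟩
    | one => exact ⟨fun x => le_rfl, rfl⟩
    | mul A B _ _ hA hB =>
      exact ⟨fun x => (hA.1 (B x)).trans (hB.1 x), by
        rw [mul_apply_eq_comp, hB.2, hA.2]⟩
  let N : Submodule 𝕜 E := Submodule.span 𝕜 (Set.range fun p : ι × E => T p.1 p.2 - p.2)
  -- Cesàro means shrink each generator `T x - x` by telescoping. For sums, multiply the two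
  -- operators: they commute, so each can act first on its own summand.
  have hN : ∀ h ∈ N, ∀ ε > 0, ∃ A ∈ Submonoid.closure C, ‖A h‖ ≤ ε := by
    intro h hh
    induction hh using Submodule.span_induction with
    | mem h hh =>
      obtain ⟨⟨i, x⟩, rfl⟩ := hh
      intro ε hε
      obtain ⟨n, hn⟩ := exists_nat_gt (2 * ‖x‖ / ε)
      refine ⟨cesaro (T i) n, Submonoid.subset_closure ⟨(i, n), rfl⟩, ?_⟩
      refine (norm_cesaro_apply_sub_le (hT i) n x).trans ?_
      rw [div_lt_iff₀ hε] at hn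
      rw [div_le_iff₀ (by positivity)]
      nlinarith
    | zero => exact fun ε hε => ⟨1, one_mem _, by simpa using hε.le⟩
    | add h k _ _ ih ik =>
      intro ε hε
      obtain ⟨A, hA, hAh⟩ := ih (ε / 2) (by positivity)
      obtain ⟨B, hB, hBk⟩ := ik (ε / 2) (by positivity)
      refine ⟨A * B, mul_mem hA hB, ?_⟩
      rw [map_add]
      refine (norm_add_le _ _).trans ?_
      have h₁ : ‖(A * B) h‖ ≤ ε / 2 := by
        rw [hCc A hA B hB]
        exact ((hC B hB).1 _).trans hAh
      have h₂ : ‖(A * B) k‖ ≤ ε / 2 := ((hC A hA).1 _).trans hBk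
      linarith
    | smul a h _ ih =>
      intro ε hε
      obtain ⟨A, hA, hAh⟩ := ih (ε / (‖a‖ + 1)) (by positivity)
      refine ⟨A, hA, ?_⟩
      rw [map_smul, norm_smul]
      rw [le_div_iff₀ (by positivity)] at hAh
      nlinarith [norm_nonneg (A h)]
  -- Thus `v` has distance `1` from `N`, and Hahn–Banach in `E ⧸ N` supplies the functional.
  have hdist : ∀ h ∈ N, 1 ≤ ‖v + h‖ := by
    intro h hh
    refine le_of_forall_pos_le_add fun ε hε => ?_
    obtain ⟨A, hA, hAh⟩ := hN h hh ε hε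
    calc (1 : ℝ) = ‖A (v + h) - A h‖ := by rw [map_add, add_sub_cancel_right, (hC A hA).2, hv]
      _ ≤ ‖A (v + h)‖ + ‖A h‖ := norm_sub_le _ _
      _ ≤ ‖v + h‖ + ε := add_le_add ((hC A hA).1 _) hAh
  obtain ⟨g, hg, hgv⟩ := exists_dual_vector'' 𝕜 (Submodule.Quotient.mk v : E ⧸ N)
  have hmk : ‖(Submodule.Quotient.mk v : E ⧸ N)‖ = 1 := by
    refine le_antisymm ((Submodule.Quotient.norm_mk_le _ v).trans hv.le) ?_
    refine QuotientAddGroup.le_norm_iff.2 fun x hx => ?_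
    have : x - v ∈ N := (Submodule.Quotient.eq N).1 hx
    simpa using hdist _ this
  let q : E →L[𝕜] E ⧸ N := LinearMap.mkContinuous N.mkQ 1 fun x => by
    simpa using Submodule.Quotient.norm_mk_le N x
  refine ⟨g.comp q, ?_, ?_, fun i x => ?_⟩
  · refine (g.opNorm_comp_le _).trans (mul_le_one₀ hg (norm_nonneg _) ?_)
    exact LinearMap.mkContinuous_norm_le _ zero_le_one _
  · change g (Submodule.Quotient.mk v) = 1
    rw [hgv, hmk, RCLike.ofReal_one]
  · change g (Submodule.Quotient.mk _) = g (Submodule.Quotient.mk _)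
    congr 1
    exact (Submodule.Quotient.eq N).2 (Submodule.subset_span ⟨(i, x), rfl⟩)

/-- Nonempty commutative semigroups are amenable. -/
theorem isAmenable_of_comm (𝕜 : Type*) [RCLike 𝕜] (S : Type*) [CommSemigroup S] [Nonempty S] :
    IsAmenable 𝕜 S := by
  have hv : ‖const S (1 : 𝕜)‖ = 1 := by
    refine le_antisymm (lp.norm_le_of_forall_le zero_le_one fun s => by simp) ?_
    obtain ⟨s⟩ := ‹Nonempty S›
    simpa using norm_apply_le (const S (1 : 𝕜)) s
  obtain ⟨m, hm, hm1, hmT⟩ := exists_invariant_functional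
    (fun s : S => compL 𝕜 𝕜 fun t => s * t) (fun s t => by
      ext f r
      change f (t * (s * r)) = f (s * (t * r))
      rw [mul_left_comm]) (fun s => norm_compL_le _) hv (fun s => rfl)
  refine ⟨m, hm, fun x => ?_, fun s f => hmT s f, fun s f => ?_⟩
  · have : const S x = x • const S (1 : 𝕜) := by
      ext s
      simp
    rw [this, map_smul, hm1, smul_eq_mul, mul_one]
  · rw [← hmT s f]
    congr 1
    ext t
    exact congrArg f (mul_comm t s)

end Amenable

end

end VectorMean

namespace VectorMean

noncomputable section

/-! ### Approximate solution of relations in `X` -/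

section LocalReflexivity

variable {𝕜 : Type*} [RCLike 𝕜] {X : Type*} [NormedAddCommGroup X] [NormedSpace 𝕜 X]

lemma exists_norm_le_and_lt_re_apply (z : StrongDual 𝕜 X) {r δ : ℝ} (hr : 0 ≤ r) (hδ : 0 < δ) :
    ∃ x : X, ‖x‖ ≤ r ∧ r * ‖z‖ - δ < RCLike.re (z x) := by
  rcases hr.eq_or_lt with rfl | hr
  · exact ⟨0, by simp, by simpa using hδ⟩
  rcases (norm_nonneg z).eq_or_lt with hz | hz
  · exact ⟨0, by simpa using hr.le, by simpa [← hz] using hδ⟩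
  obtain ⟨x, hx, hzx⟩ := z.exists_lt_apply_of_lt_opNorm
    (show ‖z‖ - δ / r < ‖z‖ from sub_lt_self _ (by positivity))
  obtain ⟨a, ha, hax⟩ := RCLike.exists_norm_eq_mul_self (z x)
  refine ⟨((r : 𝕜) * a) • x, ?_, ?_⟩
  · rw [norm_smul, norm_mul, ha, mul_one, RCLike.norm_ofReal, abs_of_pos hr]
    exact mul_le_of_le_one_right hr.le hx.le
  · rw [map_smul, smul_eq_mul, mul_assoc, ← hax, ← RCLike.ofReal_mul, RCLike.ofReal_re]
    have := mul_lt_mul_of_pos_left hzx hr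
    rwa [mul_sub, mul_div_cancel₀ _ hr.ne'] at this

/-- Finitely many linear relations in `X**` with right-hand sides in `X` are approximately
satisfied by vectors of `X` of no larger norm. -/
theorem exists_approx_relations {J : Type*} [Fintype J] (a : J → Bidual 𝕜 X →₀ 𝕜) (y : J → X)
    (h : ∀ j, (a j).sum (fun ξ t => t • ξ) = NormedSpace.inclusionInDoubleDual 𝕜 X (y j))
    {ε : ℝ} (hε : 0 < ε) :
    ∃ x : Bidual 𝕜 X → X, (∀ ξ, ‖x ξ‖ ≤ ‖ξ‖) ∧
      ∀ j, ‖(a j).sum (fun ξ t => t • x ξ) - y j‖ < ε := by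
  classical
  let _ : NormedSpace ℝ X := NormedSpace.restrictScalars ℝ 𝕜 X
  have : IsScalarTower ℝ 𝕜 X := RestrictScalars.isScalarTower ℝ 𝕜 X
  let L : (Bidual 𝕜 X → X) → J → X := fun x j => (a j).sum fun ξ t => t • x ξ
  let D : Set (J → X) := L '' {x | ∀ ξ, ‖x ξ‖ ≤ ‖ξ‖}
  suffices hy : y ∈ closure D by
    obtain ⟨_, ⟨x, hx, rfl⟩, hd⟩ := Metric.mem_closure_iff.1 hy ε hε
    refine ⟨x, hx, fun j => ?_⟩
    rw [← dist_eq_norm, dist_comm]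
    exact (dist_le_pi_dist y (L x) j).trans_lt hd
  have hD : Convex ℝ D := by
    rintro _ ⟨x, hx, rfl⟩ _ ⟨x', hx', rfl⟩ s t hs ht hst
    refine ⟨fun ξ => s • x ξ + t • x' ξ, fun ξ => ?_, ?_⟩
    · refine (norm_add_le _ _).trans ?_
      rw [norm_smul, norm_smul, Real.norm_of_nonneg hs, Real.norm_of_nonneg ht]
      calc s * ‖x ξ‖ + t * ‖x' ξ‖ ≤ s * ‖ξ‖ + t * ‖ξ‖ :=
            add_le_add (mul_le_mul_of_nonneg_left (hx ξ) hs)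
              (mul_le_mul_of_nonneg_left (hx' ξ) ht)
        _ = ‖ξ‖ := by rw [← add_mul, hst, one_mul]
    · funext j
      simp only [L, Finsupp.sum, Pi.add_apply, Pi.smul_apply, Finset.smul_sum,
        ← Finset.sum_add_distrib, smul_add]
      refine Finset.sum_congr rfl fun ξ _ => ?_
      rw [smul_comm s, smul_comm t]
  by_contra hy
  -- A separating `f` satisfies `f y = ∑ ξ (z ξ)`, whose real part is at most `∑ ‖ξ‖ * ‖z ξ‖`.
  -- Choosing each `x ξ` to nearly norm `z ξ` makes `re (f (L x))` almost reach that bound, against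
  -- separation.
  obtain ⟨f, u, hfu, huf⟩ := RCLike.geometric_hahn_banach_closed_point (𝕜 := 𝕜) hD.closure
    isClosed_closure hy
  let fj : J → StrongDual 𝕜 X := fun j =>
    f.comp (ContinuousLinearMap.single 𝕜 (fun _ : J => X) j)
  have hf : ∀ d : J → X, f d = ∑ j, fj j (d j) := fun d => by
    conv_lhs => rw [← Finset.univ_sum_single d, map_sum]
    rfl
  let U : Finset (Bidual 𝕜 X) := Finset.univ.biUnion fun j => (a j).support
  have hU : ∀ j, (a j).support ⊆ U := fun j =>
    Finset.subset_biUnion_of_mem (fun j => (a j).support) (Finset.mem_univ j)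
  let z : Bidual 𝕜 X → StrongDual 𝕜 X := fun ξ => ∑ j, a j ξ • fj j
  have hfL : ∀ x, f (L x) = ∑ ξ ∈ U, z ξ (x ξ) := fun x => by
    simp only [hf, L, z, sum_apply, smul_apply]
    rw [Finset.sum_comm]
    refine Finset.sum_congr rfl fun j _ => ?_
    rw [Finsupp.sum_of_support_subset _ (hU j) _ (by simp), map_sum]
    simp only [map_smul]
  have hfy : f y = ∑ ξ ∈ U, ξ (z ξ) := by
    simp only [hf, z, map_sum, map_smul]
    rw [Finset.sum_comm]
    refine Finset.sum_congr rfl fun j _ => ?_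
    have := congrArg (fun η : Bidual 𝕜 X => η (fj j)) (h j)
    rw [Finsupp.sum_of_support_subset _ (hU j) _ (by simp)] at this
    simp only [sum_apply, smul_apply, NormedSpace.dual_def] at this
    exact this.symm
  -- The `+ 1` keeps the total loss `U.card * δ` strictly below the separation gap.
  let δ : ℝ := (RCLike.re (f y) - u) / (U.card + 1)
  have hδ : 0 < δ := div_pos (sub_pos.2 huf) (by positivity)
  choose x hx hxz using fun ξ : Bidual 𝕜 X =>
    exists_norm_le_and_lt_re_apply (z ξ) (norm_nonneg ξ) hδ
  have h₁ := hfu (L x) (subset_closure ⟨x, hx, rfl⟩)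
  have h₂ : RCLike.re (f y) - U.card * δ ≤ RCLike.re (f (L x)) := by
    rw [hfL, hfy, map_sum, map_sum, ← nsmul_eq_mul, ← Finset.sum_const, ← Finset.sum_sub_distrib]
    refine Finset.sum_le_sum fun ξ _ => le_trans ?_ (hxz ξ).le
    exact sub_le_sub_right ((RCLike.re_le_norm _).trans (ξ.le_opNorm _)) _
  have h₃ : (U.card + 1) * δ = RCLike.re (f y) - u := mul_div_cancel₀ _ (by positivity)
  linarith

end LocalReflexivity

/-! ### Null subgroups of invariant means -/

section NullSets

variable {𝕜 : Type*} [RCLike 𝕜] {X : Type*} [NormedAddCommGroup X] [NormedSpace 𝕜 X]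
  {G : Type*} [AddCommGroup G] {c : ℝ} {M : Linfty (Multiplicative G) X →L[𝕜] X}

/-- An invariant mean vanishes on the functions supported by the kernel of a surjective
homomorphism to `ℚ`. -/
theorem IsInvariantMean.eq_zero_of_support (hM : IsInvariantMean c M) (q : G →+ ℚ) {e : G}
    (he : q e = 1) (f : Linfty (Multiplicative G) X)
    (hf : ∀ g : G, q g ≠ 0 → f (Multiplicative.ofAdd g) = 0) : M f = 0 := by
  let F : ℕ → Linfty (Multiplicative G) X := fun i =>
    leftTranslate (Multiplicative.ofAdd (i • e)) f
  have hF : ∀ (i : ℕ) (g : Multiplicative G), q g.toAdd ≠ -i → F i g = 0 := fun i g hg => by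
    refine hf (i • e + g.toAdd) fun h => hg ?_
    rw [map_add, map_nsmul, he] at h
    simp only [nsmul_eq_mul, mul_one] at h
    linarith
  -- The translates live on the disjoint fibres `q = -i`, so their sum does not grow, while its mean
  -- is `n • M f`.
  have hnorm : ∀ n, ‖∑ i ∈ Finset.range n, F i‖ ≤ ‖f‖ := fun n => by
    refine lp.norm_le_of_forall_le (norm_nonneg f) fun g => ?_
    rw [lp.coeFn_sum, Finset.sum_apply]
    by_cases h : ∃ i : ℕ, i ∈ Finset.range n ∧ q g.toAdd = -i
    · obtain ⟨i, hi, hgi⟩ := h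
      rw [Finset.sum_eq_single_of_mem i hi fun j _ hj => hF j g ?_]
      · exact norm_apply_le f _
      · rw [hgi]
        exact fun h => hj (Nat.cast_injective (neg_injective h)).symm
    · push Not at h
      rw [Finset.sum_eq_zero fun i hi => hF i g (h i hi), norm_zero]
      exact norm_nonneg f
  have hbound : ∀ n : ℕ, n * ‖M f‖ ≤ c * ‖f‖ := fun n => by
    have h : M (∑ i ∈ Finset.range n, F i) = n • M f := by
      rw [map_sum, Finset.sum_congr rfl fun i _ => hM.map_left _ f, Finset.sum_const,
        Finset.card_range]
    have hc : 0 ≤ c := (norm_nonneg M).trans hM.norm_le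
    calc n * ‖M f‖ = ‖n • M f‖ := by
          rw [← Nat.cast_smul_eq_nsmul 𝕜, norm_smul, RCLike.norm_natCast]
      _ ≤ c * ‖∑ i ∈ Finset.range n, F i‖ := h ▸ M.le_of_opNorm_le hM.norm_le _
      _ ≤ c * ‖f‖ := mul_le_mul_of_nonneg_left (hnorm n) hc
  by_contra hne
  have hpos : 0 < ‖M f‖ := norm_pos_iff.2 hne
  obtain ⟨n, hn⟩ := exists_nat_gt (c * ‖f‖ / ‖M f‖)
  rw [div_lt_iff₀ hpos] at hn
  exact absurd (hbound n) (not_le.2 hn)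

/-- A bound for a function off the kernel of a surjective homomorphism to `ℚ` bounds its
invariant mean. -/
theorem IsInvariantMean.norm_apply_le_of_ne_zero (hM : IsInvariantMean c M) (q : G →+ ℚ)
    {e : G} (he : q e = 1) (f : Linfty (Multiplicative G) X) {C : ℝ} (hC : 0 ≤ C)
    (hf : ∀ g : G, q g ≠ 0 → ‖f (Multiplicative.ofAdd g)‖ ≤ C) : ‖M f‖ ≤ c * C := by
  classical
  let f₁ : Linfty (Multiplicative G) X :=
    ofBound (fun g => if q g.toAdd = 0 then 0 else f g) C fun g => by
      split_ifs with h
      · simpa using hC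
      · exact hf g.toAdd h
  have h₀ : M (f - f₁) = 0 := hM.eq_zero_of_support q he _ fun g hg => by
    rw [lp.coeFn_sub, Pi.sub_apply, ofBound_apply]
    simp [hg]
  rw [map_sub, sub_eq_zero] at h₀
  rw [h₀]
  refine (M.le_of_opNorm_le hM.norm_le _).trans ?_
  refine mul_le_mul_of_nonneg_left ?_ ((norm_nonneg M).trans hM.norm_le)
  refine lp.norm_le_of_forall_le hC fun g => ?_
  rw [ofBound_apply]
  split_ifs with h
  · simpa using hC
  · exact hf g.toAdd h

end NullSets

/-! ### From a mean on `X**` to a projection -/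

section Projection

variable {𝕜 : Type*} [RCLike 𝕜] {X : Type*} [NormedAddCommGroup X] [NormedSpace 𝕜 X]

variable (𝕜 X) in
/-- The linear relations in `X**` with right-hand side in `X`, each with a tolerance
`1 / (n + 1)`. -/
abbrev Relation : Type _ :=
  {a : Bidual 𝕜 X →₀ 𝕜 // ∃ y : X, a.sum (fun ξ t => t • ξ) =
    NormedSpace.inclusionInDoubleDual 𝕜 X y} × ℕ

lemma exists_approx_finset (Φ : Finset (Relation 𝕜 X)) :
    ∃ x : Bidual 𝕜 X → X, (∀ ξ, ‖x ξ‖ ≤ ‖ξ‖) ∧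
      ∀ r ∈ Φ, ‖r.1.1.sum (fun ξ t => t • x ξ) - r.1.2.choose‖ ≤ 1 / ((r.2 : ℝ) + 1) := by
  -- All factors are at most `1`, so the product lies below each tolerance; it is positive even for
  -- empty `Φ`.
  let ε : ℝ := ∏ r ∈ Φ, 1 / ((r.2 : ℝ) + 1)
  have hpos : ∀ r : Relation 𝕜 X, 0 < 1 / ((r.2 : ℝ) + 1) := fun r => by positivity
  have hε : 0 < ε := Finset.prod_pos fun r _ => hpos r
  obtain ⟨x, hx, hxr⟩ := exists_approx_relations (J := Φ) (fun r => r.1.1.1)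
    (fun r => r.1.1.2.choose) (fun r => r.1.1.2.choose_spec) hε
  refine ⟨x, hx, fun r hr => (hxr ⟨r, hr⟩).le.trans ?_⟩
  classical
  rw [show ε = _ from (Finset.mul_prod_erase Φ _ hr).symm]
  refine mul_le_of_le_one_right (hpos r).le (Finset.prod_le_one (fun s _ => (hpos s).le) ?_)
  intro s _
  rw [div_le_one (by positivity)]
  linarith [s.2.cast_nonneg (α := ℝ)]

/-- A nontrivial `X**` has at least the cardinality of `𝕜` and is infinite, so finitely supported
functions and the factor `ℕ` add nothing. -/
lemma mk_relation_le {𝕜 : Type v} [RCLike 𝕜] {X : Type u} [NormedAddCommGroup X]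
    [NormedSpace 𝕜 X] [Nontrivial X] :
    Cardinal.mk (Relation 𝕜 X) ≤ Cardinal.mk (Bidual 𝕜 X) := by
  have : Nontrivial (Bidual 𝕜 X) :=
    (NormedSpace.inclusionInDoubleDualLi (E := X) 𝕜).injective.nontrivial
  have hinf : Cardinal.aleph0 ≤ Cardinal.mk (Bidual 𝕜 X) :=
    Cardinal.aleph0_le_continuum.trans (continuum_le_cardinal_of_module 𝕜 _)
  have : Infinite (Bidual 𝕜 X) := Cardinal.infinite_iff.2 hinf
  have hle := Cardinal.mk_le_of_module 𝕜 (Bidual 𝕜 X)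
  have h₁ : Cardinal.mk (Bidual 𝕜 X →₀ 𝕜) ≤ Cardinal.mk (Bidual 𝕜 X) := by
    rw [Cardinal.mk_finsupp_lift_of_infinite]
    refine max_le ?_ ?_
    · exact (Cardinal.lift_id'.{v, max u v} _).le
    · exact hle.trans (Cardinal.lift_id'.{v, max u v} _).le
  rw [Cardinal.mk_prod, Cardinal.lift_id', Cardinal.mk_nat, Cardinal.lift_aleph0]
  exact (mul_le_mul' ((Cardinal.mk_subtype_le _).trans h₁) hinf).trans
    (Cardinal.mul_eq_self hinf).le

/-- If the additive group of `X**` carries an `X`-valued invariant `c`-mean, then `X` is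
`c`-complemented in `X**`. -/
theorem HasInvariantMean.isComplementedInBidual {c : ℝ}
    (h : HasInvariantMean 𝕜 (Multiplicative (Bidual 𝕜 X)) X c) :
    IsComplementedInBidual 𝕜 X c := by
  classical
  obtain ⟨M, hM⟩ := h
  have hc : 0 ≤ c := (norm_nonneg M).trans hM.norm_le
  -- For trivial `X` the tolerances alone outnumber the points of `X**`.
  rcases subsingleton_or_nontrivial X with hX | hX
  · refine ⟨0, fun ξ => rfl, ?_, by simpa using hc⟩
    ext ξ
    simp [Subsingleton.elim _ (0 : X), eq_comm]
  have : Nontrivial (Bidual 𝕜 X) :=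
    (NormedSpace.inclusionInDoubleDualLi (E := X) 𝕜).injective.nontrivial
  let _ : Module ℚ (Bidual 𝕜 X) := Module.compHom _ (algebraMap ℚ 𝕜)
  let b := Module.Basis.ofVectorSpace ℚ (Bidual 𝕜 X)
  have hb : Cardinal.mk (Relation 𝕜 X) ≤
      Cardinal.mk (Module.Basis.ofVectorSpaceIndex ℚ (Bidual 𝕜 X)) := by
    rw [b.mk_eq_rank'', Module.Free.rank_eq_mk_of_infinite_lt]
    · exact mk_relation_le
    · rw [Cardinal.lift_id', Cardinal.mk_eq_aleph0 ℚ, Cardinal.lift_aleph0]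
      exact Cardinal.aleph0_lt_continuum.trans_le (continuum_le_cardinal_of_module 𝕜 _)
  obtain ⟨ι⟩ := hb
  choose x hx hxr using exists_approx_finset (𝕜 := 𝕜) (X := X)
  let Φ : Bidual 𝕜 X → Finset (Relation 𝕜 X) := fun g =>
    (b.repr g).support.preimage ι ι.injective.injOn
  let F : Bidual 𝕜 X → Linfty (Multiplicative (Bidual 𝕜 X)) X := fun ξ =>
    ofBound (fun g => x (Φ g.toAdd) ξ) ‖ξ‖ fun g => hx _ ξ
  have hrel : ∀ (a : Bidual 𝕜 X →₀ 𝕜) (y : X), a.sum (fun ξ t => t • ξ) =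
      NormedSpace.inclusionInDoubleDual 𝕜 X y → a.sum (fun ξ t => t • M (F ξ)) = y := by
    intro a y hay
    have hy : (⟨y, hay⟩ : ∃ y : X, a.sum (fun ξ t => t • ξ) =
        NormedSpace.inclusionInDoubleDual 𝕜 X y).choose = y :=
      (NormedSpace.inclusionInDoubleDualLi (E := X) 𝕜).injective
        ((⟨y, hay⟩ : ∃ y : X, a.sum (fun ξ t => t • ξ) =
          NormedSpace.inclusionInDoubleDual 𝕜 X y).choose_spec.symm.trans hay)
    let f : Linfty (Multiplicative (Bidual 𝕜 X)) X := a.sum (fun ξ t => t • F ξ) - const _ y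
    have hMf : M f = a.sum (fun ξ t => t • M (F ξ)) - y := by
      simp only [f, Finsupp.sum, map_sub, map_sum, map_smul, hM.map_const]
    -- The same relation occurs with every tolerance; coordinate `ι r` is nonzero at `g` exactly
    -- when `r ∈ Φ g`.
    have hbound : ∀ n : ℕ, ‖M f‖ ≤ c * (1 / ((n : ℝ) + 1)) := fun n => by
      let r : Relation 𝕜 X := (⟨a, y, hay⟩, n)
      refine hM.norm_apply_le_of_ne_zero (b.coord (ι r)).toAddMonoidHom (e := b (ι r)) ?_ f
        (by positivity) fun g hg => ?_
      · simp
      · have := hxr (Φ g) r (by simpa [Φ] using hg)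
        simp only [r, hy] at this
        convert this using 2
        simp only [f, F, Finsupp.sum, lp.coeFn_sub, Pi.sub_apply, lp.coeFn_sum, const_apply,
          Finset.sum_apply, lp.coeFn_smul, Pi.smul_apply, ofBound_apply, toAdd_ofAdd]
    have hlim : Filter.Tendsto (fun n : ℕ => c * (1 / ((n : ℝ) + 1))) Filter.atTop (nhds 0) := by
      simpa using tendsto_one_div_add_atTop_nhds_zero_nat.const_mul c
    rw [← sub_eq_zero, ← hMf, ← norm_le_zero_iff]
    exact ge_of_tendsto' hlim hbound
  let T : Bidual 𝕜 X →L[𝕜] X := LinearMap.mkContinuous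
    { toFun := fun ξ => M (F ξ)
      map_add' := fun ξ η => by
        have := hrel (Finsupp.single (ξ + η) 1 - (Finsupp.single ξ 1 + Finsupp.single η 1)) 0
        simp only [Finsupp.sum_sub_index, Finsupp.sum_add_index', Finsupp.sum_single_index,
          sub_smul, add_smul, zero_smul, one_smul, map_zero, sub_self, forall_const] at this
        exact sub_eq_zero.1 this
      map_smul' := fun t ξ => by
        have := hrel (Finsupp.single (t • ξ) 1 - Finsupp.single ξ t) 0
        simp only [Finsupp.sum_sub_index, Finsupp.sum_single_index,
          sub_smul, zero_smul, one_smul, map_zero, sub_self, forall_const] at this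
        exact sub_eq_zero.1 this } c fun ξ => by
      refine (M.le_of_opNorm_le hM.norm_le _).trans (mul_le_mul_of_nonneg_left ?_ hc)
      exact lp.norm_le_of_forall_le (norm_nonneg ξ) fun g => hx _ ξ
  have hT : ∀ y : X, T (NormedSpace.inclusionInDoubleDual 𝕜 X y) = y := fun y => by
    have := hrel (Finsupp.single (NormedSpace.inclusionInDoubleDual 𝕜 X y) 1) y
    simp only [Finsupp.sum_single_index, zero_smul, one_smul, forall_const] at this
    exact this
  refine ⟨(NormedSpace.inclusionInDoubleDual 𝕜 X).comp T, fun ξ => ?_, ?_, ?_⟩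
  · simp only [ContinuousLinearMap.comp_apply, hT]
  · refine Set.Subset.antisymm ?_ ?_
    · rintro _ ⟨ξ, rfl⟩
      exact ⟨T ξ, rfl⟩
    · rintro _ ⟨y, rfl⟩
      exact ⟨NormedSpace.inclusionInDoubleDual 𝕜 X y, by
        simp only [ContinuousLinearMap.comp_apply, hT]⟩
  · refine (ContinuousLinearMap.opNorm_comp_le _ T).trans ?_
    exact (mul_le_of_le_one_left (norm_nonneg T)
      (NormedSpace.inclusionInDoubleDual_norm_le 𝕜 X)).trans
      (LinearMap.mkContinuous_norm_le _ hc _)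

end Projection

end

end VectorMean

theorem theoremA {𝕜 : Type v} [RCLike 𝕜] {X : Type u} [NormedAddCommGroup X]
    [NormedSpace 𝕜 X] [CompleteSpace X] (c : ℝ) (hc : 1 ≤ c) :
    List.TFAE [
      VectorMean.IsComplementedInBidual 𝕜 X c,
      ∀ (S : Type (max u v w)) [Semigroup S],
        VectorMean.IsAmenable 𝕜 S → VectorMean.HasInvariantMean 𝕜 S X c,
      ∀ (G : Type (max u v w)) [AddCommGroup G] [Module.Free ℤ G],
        Module.rank ℤ G = Cardinal.lift.{w} (Cardinal.mk (VectorMean.Bidual 𝕜 X)) →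
          VectorMean.HasInvariantMean 𝕜 (Multiplicative G) X c,
      VectorMean.HasInvariantMean 𝕜 (Multiplicative (VectorMean.Bidual 𝕜 X)) X c] := by
  tfae_have 1 → 2 := fun h S _ hS => h.hasInvariantMean hS
  tfae_have 2 → 3 := fun h G _ _ _ => h _ (VectorMean.isAmenable_of_comm 𝕜 _)
  tfae_have 3 → 4 := fun h => by
    let V := VectorMean.Bidual 𝕜 X
    have hG := h (ULift.{w} (V →₀ ℤ)) (by rw [rank_ulift, rank_finsupp_self, Cardinal.lift_uzero])
    let φ : ULift.{w} (V →₀ ℤ) →+ V :=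
      (Finsupp.linearCombination ℤ (id : V → V)).toAddMonoidHom.comp
        AddEquiv.ulift.toAddMonoidHom
    refine hG.of_surjective (AddMonoidHom.toMultiplicative φ).toMulHom fun ξ => ?_
    refine ⟨Multiplicative.ofAdd (ULift.up (Finsupp.single ξ.toAdd 1)), ?_⟩
    change Multiplicative.ofAdd (Finsupp.linearCombination ℤ (id : V → V)
      (Finsupp.single ξ.toAdd 1)) = ξ
    simp
  tfae_have 4 → 1 := fun h => h.isComplementedInBidual
  tfae_finish
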